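/- Let $H$ be a complex, separable, infinite-dimensional Hilbert space, let $L(H)$ be the algebra of bounded linear operators on $H$, and let $I$ be the identity operator. For $T\in L(H)$, let $\rho_\ell(T)$ be the set of all $\lambda\in\mathbb{C}$ such that $\lambda I-T$ is left invertible in $L(H)$, i.e. $L(\lambda I-T)=I$ for some $L\in L(H)$, and let $\sigma_\ell(T)=\mathbb{C}\setminus\rho_\ell(T)$. For $S\in L(H)$, let $r_\sigma(S)$ be the spectral radius of $S$. Suppose that $T\in L(H)$ and $0\in\rho_\ell(T)$. Then $\sigma_\ell(T)\neq\emptyset$, $r_\sigma(S)>0$ for every $S\in L(H)$ with $ST=I$, and $$\operatorname{dist}(0,\sigma_\ell(T))=\sup\left\{\frac{1}{r_\sigma(S)} : S\in L(H),\ ST=I\right\},$$ where the supremum is over a non-empty set that is bounded above. -/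

import Mathlib

/-- The left resolvent set of a bounded operator `T` on `H`: all `z : ℂ` such that `z I - T` has a
left inverse in the algebra `H →L[ℂ] H` of bounded operators (multiplication is composition). -/
def leftResolventSet {H : Type*} [NormedAddCommGroup H] [InnerProductSpace ℂ H]
    (T : H →L[ℂ] H) : Set ℂ :=
  {z | ∃ L : H →L[ℂ] H, L * (z • (1 : H →L[ℂ] H) - T) = 1}

/-- The left spectrum of `T`: the complement of the left resolvent set in `ℂ`. -/
def leftSpectrum {H : Type*} [NormedAddCommGroup H] [InnerProductSpace ℂ H]
    (T : H →L[ℂ] H) : Set ℂ :=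
  (leftResolventSet T)ᶜ

/-! If `S * T = 1`, then `S (z - T) = -(1 - z S)`, so `z - T` is left invertible for `‖z‖ < 1 /
r(S)`; thus each `1 / r(S)` is at most the distance.

Conversely, let `r` be less than the distance. By compactness `z - T` is uniformly bounded below on
the disc of radius `r`. Applying this to `∑ z^k T^(n-1-k) x`, which `z - T` maps to `z^n x - T^n x`,
and averaging over a circle by Parseval bounds an orbit segment by its ends
(`sum_orbit_le_of_boundedBelow`). Such a sequence is dominated by a decaying part plus a multiple of
its last term, so weak geometric growth of orbits improves by a fixed ratio until it reaches `‖T^n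
x‖ ≥ K r^n ‖x‖` (`HasOrbitGrowth.of_boundedBelow`). For `ρ < r` an equivalent Hilbert norm then
makes `T` expand by `ρ`, and its Moore-Penrose inverse there has norm at most `1 / ρ`
(`exists_leftInverse_spectrum_le`). -/

open Finset in
/-- Parseval's identity for vector-valued trigonometric polynomials sampled at roots of unity. -/
theorem IsPrimitiveRoot.sum_norm_sq_sum_smul {E : Type*} [NormedAddCommGroup E]
    [InnerProductSpace ℂ E] {ω : ℂ} {N : ℕ} (hω : IsPrimitiveRoot ω N) (hN : N ≠ 0)
    (s : Finset ℕ) (hs : s ⊆ range N) (v : ℕ → E) :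
    ∑ m ∈ range N, ‖∑ k ∈ s, (ω ^ m) ^ k • v k‖ ^ 2 = N * ∑ k ∈ s, ‖v k‖ ^ 2 := by
  have hn : ‖ω‖ = 1 := hω.norm'_eq_one hN
  have hc : ∀ k, (starRingEnd ℂ) (ω ^ k) * ω ^ k = 1 := fun k => by
    rw [mul_comm, Complex.mul_conj, Complex.normSq_eq_norm_sq, norm_pow, hn]; simp
  have horth : ∀ k ∈ s, ∀ l ∈ s, ∑ m ∈ range N, (starRingEnd ℂ) ((ω ^ m) ^ k) * (ω ^ m) ^ l
      = if k = l then (N : ℂ) else 0 := by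
    intro k hk l hl
    have hpow : ∀ m, (starRingEnd ℂ) ((ω ^ m) ^ k) * (ω ^ m) ^ l
        = ((starRingEnd ℂ) (ω ^ k) * ω ^ l) ^ m := fun m => by
      rw [mul_pow, pow_right_comm ω m k, pow_right_comm ω m l, map_pow]
    simp_rw [hpow]
    split_ifs with h
    · subst h; simp only [hc]; simp
    · have h1 : (starRingEnd ℂ) (ω ^ k) * ω ^ l ≠ 1 := by
        intro h1
        apply h
        apply hω.pow_inj (mem_range.1 (hs hk)) (mem_range.1 (hs hl))
        calc ω ^ k = ω ^ k * ((starRingEnd ℂ) (ω ^ k) * ω ^ l) := by rw [h1, mul_one]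
          _ = ((starRingEnd ℂ) (ω ^ k) * ω ^ k) * ω ^ l := by ring
          _ = ω ^ l := by rw [hc, one_mul]
      have h2 : ((starRingEnd ℂ) (ω ^ k) * ω ^ l) ^ N = 1 := by
        rw [mul_pow, ← map_pow, ← pow_mul, ← pow_mul, mul_comm k, mul_comm l, pow_mul, pow_mul,
          hω.pow_eq_one]; simp
      rw [geom_sum_eq h1, h2]; simp
  have key : ((∑ m ∈ range N, ‖∑ k ∈ s, (ω ^ m) ^ k • v k‖ ^ 2 : ℝ) : ℂ)
      = ((N * ∑ k ∈ s, ‖v k‖ ^ 2 : ℝ) : ℂ) := by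
    push_cast
    have : ∀ x : E, ((‖x‖ : ℂ)) ^ 2 = inner ℂ x x := fun x => by
      rw [inner_self_eq_norm_sq_to_K]; rfl
    simp_rw [this, sum_inner, inner_sum, inner_smul_left, inner_smul_right]
    rw [sum_comm, mul_sum]
    refine sum_congr rfl fun k hk => ?_
    rw [sum_comm]
    calc _ = ∑ l ∈ s, (if k = l then (N : ℂ) else 0) * inner ℂ (v k) (v l) := by
            refine sum_congr rfl fun l hl => ?_
            rw [← horth k hk l hl, sum_mul]
            exact sum_congr rfl fun m _ => by ring
      _ = _ := by simp [ite_mul, hk]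
  exact_mod_cast key

/-! ### Geometric growth of orbits. -/

section Growth

variable {H : Type*} [NormedAddCommGroup H] [InnerProductSpace ℂ H]

open Finset in
/-- If `z - T` is bounded below by `c` on the disc of radius `r`, then the weighted square sum of
an orbit segment is controlled by its two ends. -/
theorem sum_orbit_le_of_boundedBelow {T : H →L[ℂ] H} {c r t : ℝ} (hc : 0 < c) (ht : 0 < t)
    (htr : t ≤ r)
    (h : ∀ z : ℂ, ‖z‖ ≤ r → ∀ x, c * ‖x‖ ≤ ‖(z • (1 : H →L[ℂ] H) - T) x‖) (n : ℕ) (x : H) :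
    c ^ 2 * ∑ k ∈ range n, (t ^ k * ‖(T ^ (n - 1 - k)) x‖) ^ 2
      ≤ ‖(T ^ n) x‖ ^ 2 + (t ^ n * ‖x‖) ^ 2 := by
  rcases Nat.eq_zero_or_pos n with rfl | hn
  · simp
  -- `n + 1` sample points, not `n`: the exponents `0` and `n` must stay orthogonal.
  have hω := Complex.isPrimitiveRoot_exp (n + 1) (Nat.succ_ne_zero n)
  set ω := Complex.exp (2 * Real.pi * Complex.I / ((n + 1 : ℕ) : ℂ))
  have hnω : ‖ω‖ = 1 := hω.norm'_eq_one (Nat.succ_ne_zero n)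
  have hL := hω.sum_norm_sq_sum_smul (Nat.succ_ne_zero n) (range n)
    (range_subset_range.2 n.le_succ) (fun k => ((t : ℂ) ^ k) • (T ^ (n - 1 - k)) x)
  have hR := hω.sum_norm_sq_sum_smul (Nat.succ_ne_zero n) {0, n}
    (by intro k; simp only [mem_insert, mem_singleton, mem_range]; omega)
    (fun k => if k = 0 then -(T ^ n) x else ((t : ℂ) ^ n) • x)
  have hterm : ∀ m, c ^ 2 * ‖∑ k ∈ range n, (ω ^ m) ^ k • ((t : ℂ) ^ k) • (T ^ (n - 1 - k)) x‖ ^ 2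
      ≤ ‖∑ k ∈ ({0, n} : Finset ℕ),
          (ω ^ m) ^ k • (if k = 0 then -(T ^ n) x else ((t : ℂ) ^ n) • x)‖ ^ 2 := by
    intro m
    have hz : ‖ω ^ m * t‖ ≤ r := by simp [hnω, abs_of_pos ht, htr]
    have hcomm : Commute ((ω ^ m * t) • (1 : H →L[ℂ] H)) T :=
      (Commute.one_left T).smul_left _
    have hid := congrArg (fun A : H →L[ℂ] H => A x) (hcomm.mul_geom_sum₂ n)
    have hb := h _ hz (∑ k ∈ range n, (ω ^ m) ^ k • ((t : ℂ) ^ k) • (T ^ (n - 1 - k)) x)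
    rw [← mul_pow]
    refine pow_le_pow_left₀ (by positivity) (hb.trans_eq ?_) 2
    congr 1
    rw [sum_pair hn.ne]
    have e1 : (∑ k ∈ range n, (ω ^ m) ^ k • ((t : ℂ) ^ k) • (T ^ (n - 1 - k)) x)
        = (∑ i ∈ range n, ((ω ^ m * t) • (1 : H →L[ℂ] H)) ^ i * T ^ (n - 1 - i)) x := by
      rw [_root_.sum_apply]
      refine sum_congr rfl fun k _ => ?_
      rw [smul_pow, one_pow, smul_mul_assoc, one_mul, mul_pow, mul_smul]; rfl
    rw [e1]
    refine hid.trans ?_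
    simp only [smul_pow, one_pow, if_true, if_neg hn.ne', pow_zero, one_smul, mul_pow]
    simp [mul_smul]
    abel
  have hsum := sum_le_sum fun m (_ : m ∈ range (n + 1)) => hterm m
  rw [← mul_sum, hL, hR, sum_pair hn.ne, mul_left_comm] at hsum
  have hN : (0 : ℝ) < ((n + 1 : ℕ) : ℝ) := by positivity
  have := le_of_mul_le_mul_left hsum hN
  simpa [norm_smul, hn.ne', abs_of_pos ht] using this

open Finset in
/-- A nonnegative sequence whose segment sums are controlled by the two end terms decays
geometrically, up to the last term. -/
theorem le_of_sum_Ico_le {w : ℕ → ℝ} {C : ℝ} (hC : 1 ≤ C) (hw : ∀ i, 0 ≤ w i)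
    (h : ∀ i n, i ≤ n → ∑ j ∈ Ico i n, w j ≤ C * (w i + w n)) {i n : ℕ} (hin : i < n) :
    w i ≤ C * (1 - 1 / C) ^ i * w 0 + 2 * C * w n := by
  have hθ0 : 0 ≤ 1 - 1 / C := by
    rw [sub_nonneg, div_le_one (by linarith)]; exact hC
  have hθ1 : 1 - 1 / C ≤ 1 := by
    have : 0 ≤ 1 / C := by positivity
    linarith
  have key : ∀ i, i ≤ n → ∑ j ∈ Ico i n, w j
      ≤ (1 - 1 / C) ^ i * ∑ j ∈ Ico 0 n, w j + C * w n := by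
    intro i
    induction i with
    | zero => intro _; simpa using mul_nonneg (by linarith) (hw n)
    | succ i ih =>
      intro hi
      have h1 := ih (by omega)
      have h2 := h i n (by omega)
      have h3 := sum_eq_sum_Ico_succ_bot (show i < n by omega) w
      -- Dropping `w i ≥ (∑ over Ico i n) / C - w n` from the sum contracts it by `1 - 1 / C`, up to
      -- `w n`; the fixed point of this recursion is `C * w n`.
      have h4 : ∑ j ∈ Ico (i + 1) n, w j ≤ (1 - 1 / C) * ∑ j ∈ Ico i n, w j + w n := by
        have : C * ∑ j ∈ Ico (i + 1) n, w j ≤ C * ((1 - 1 / C) * ∑ j ∈ Ico i n, w j + w n) := by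
          have e : C * ((1 - 1 / C) * ∑ j ∈ Ico i n, w j + w n)
              = (C - 1) * ∑ j ∈ Ico i n, w j + C * w n := by field_simp
          rw [e]; nlinarith
        exact le_of_mul_le_mul_left this (by linarith)
      refine h4.trans ((add_le_add_left (mul_le_mul_of_nonneg_left h1 hθ0) _).trans_eq ?_)
      rw [pow_succ]; field_simp; ring
  have h1 := key i hin.le
  have h2 := h 0 n (Nat.zero_le _)
  have h3 : w i ≤ ∑ j ∈ Ico i n, w j :=
    single_le_sum (f := w) (fun j _ => hw j) (by simp [hin])
  have hp0 : 0 ≤ (1 - 1 / C) ^ i := pow_nonneg hθ0 i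
  have hp1 : (1 - 1 / C) ^ i ≤ 1 := pow_le_one₀ hθ0 hθ1
  have h4 := mul_le_mul_of_nonneg_left h2 hp0
  have h5 : (1 - 1 / C) ^ i * (C * w n) ≤ C * w n :=
    mul_le_of_le_one_left (mul_nonneg (by linarith) (hw n)) hp1
  nlinarith

/-- The orbits of `T` grow at least like `s ^ n`, uniformly. -/
def HasOrbitGrowth (T : H →L[ℂ] H) (s : ℝ) : Prop :=
  ∃ K : ℝ, 0 < K ∧ ∀ n x, K * s ^ n * ‖x‖ ≤ ‖(T ^ n) x‖

theorem HasOrbitGrowth.mono {T : H →L[ℂ] H} {s s' : ℝ} (h : HasOrbitGrowth T s) (h0 : 0 ≤ s')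
    (hs : s' ≤ s) : HasOrbitGrowth T s' := by
  obtain ⟨K, hK, h⟩ := h
  exact ⟨K, hK, fun n x => le_trans (by gcongr) (h n x)⟩

open Finset in
/-- Growth of order `q * t` improves to growth of order `t`, with a ratio `q` that depends only on
the lower bound of `z - T` on the disc. -/
theorem HasOrbitGrowth.of_mul {T : H →L[ℂ] H} {c r t q C : ℝ} (hc : 0 < c) (ht : 0 < t)
    (htr : t ≤ r)
    (h : ∀ z : ℂ, ‖z‖ ≤ r → ∀ x, c * ‖x‖ ≤ ‖(z • (1 : H →L[ℂ] H) - T) x‖)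
    (hC : 1 ≤ C) (hrC : r ^ 2 ≤ C * c ^ 2) (hq0 : 0 < q) (hq1 : q < 1) (hqC : 1 - 1 / C ≤ q ^ 4)
    (hg : HasOrbitGrowth T (q * t)) : HasOrbitGrowth T t := by
  obtain ⟨K, hK, hg⟩ := hg
  -- This `i`, independent of `n` and `x`, makes the decaying term `C (1 - 1/C)^i w 0` at most half
  -- of the lower bound `K² q^(2i) w 0` for `w i`.
  obtain ⟨i, hi⟩ : ∃ i : ℕ, (q ^ 2) ^ i < K ^ 2 / (2 * C) :=
    exists_pow_lt_of_lt_one (by positivity) (by nlinarith)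
  rw [lt_div_iff₀ (by positivity)] at hi
  have hsq : Real.sqrt C ^ 2 = C := Real.sq_sqrt (by linarith)
  refine ⟨K * q ^ i / (2 * Real.sqrt C), by positivity, fun n x => ?_⟩
  set w : ℕ → ℝ := fun k => (‖(T ^ k) x‖ / t ^ k) ^ 2 with hw
  have hlow : ∀ k, (K * q ^ k * ‖x‖) ^ 2 ≤ w k := by
    intro k
    refine pow_le_pow_left₀ (by positivity) ?_ 2
    rw [le_div_iff₀ (by positivity)]
    calc _ = K * (q * t) ^ k * ‖x‖ := by rw [mul_pow]; ring
      _ ≤ _ := hg k x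
  have hseg : ∀ i n, i ≤ n → ∑ j ∈ Ico i n, w j ≤ C * (w i + w n) := by
    intro i n hin
    obtain ⟨m, rfl⟩ := Nat.exists_eq_add_of_le hin
    have h1 := sum_orbit_le_of_boundedBelow hc ht htr h m ((T ^ i) x)
    have hTT : ∀ j, (T ^ j) ((T ^ i) x) = (T ^ (i + j)) x := fun j => by
      rw [add_comm, pow_add]; rfl
    simp_rw [hTT] at h1
    rw [← sum_range_reflect] at h1
    have e1 : ∑ j ∈ range m, (t ^ (m - 1 - j) * ‖(T ^ (i + (m - 1 - (m - 1 - j)))) x‖) ^ 2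
        = (t ^ (i + m)) ^ 2 / t ^ 2 * ∑ j ∈ Ico i (i + m), w j := by
      rw [sum_Ico_eq_sum_range, mul_sum, Nat.add_sub_cancel_left]
      refine sum_congr rfl fun j hj => ?_
      have hj' := mem_range.1 hj
      rw [show m - 1 - (m - 1 - j) = j by omega]
      have e2 : t ^ (i + m) = t ^ (m - 1 - j) * t ^ (i + j) * t := by
        rw [← pow_add, ← pow_succ]; congr 1; omega
      simp only [hw]
      rw [e2]; field_simp
    rw [e1] at h1
    have e3 : ‖(T ^ (i + m)) x‖ ^ 2 + (t ^ m * ‖(T ^ i) x‖) ^ 2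
        = (t ^ (i + m)) ^ 2 * (w i + w (i + m)) := by
      simp only [hw]; rw [pow_add]; field_simp; ring
    rw [e3] at h1
    have hS : 0 ≤ ∑ j ∈ Ico i (i + m), w j := sum_nonneg fun j _ => sq_nonneg _
    have h2 : c ^ 2 / t ^ 2 * ∑ j ∈ Ico i (i + m), w j ≤ w i + w (i + m) := by
      refine le_of_mul_le_mul_left (le_trans (le_of_eq ?_) h1)
        (show 0 < (t ^ (i + m)) ^ 2 by positivity)
      ring
    have h3 : 1 ≤ C * (c ^ 2 / t ^ 2) := by
      rw [← mul_div_assoc, le_div_iff₀ (by positivity), one_mul]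
      exact (pow_le_pow_left₀ ht.le htr 2).trans hrC
    calc ∑ j ∈ Ico i (i + m), w j ≤ C * (c ^ 2 / t ^ 2) * ∑ j ∈ Ico i (i + m), w j :=
          le_mul_of_one_le_left hS h3
      _ = C * (c ^ 2 / t ^ 2 * ∑ j ∈ Ico i (i + m), w j) := by ring
      _ ≤ _ := by gcongr
  have hfin : (K * q ^ i / (2 * Real.sqrt C) * ‖x‖) ^ 2 ≤ w n := by
    have e : (K * q ^ i / (2 * Real.sqrt C) * ‖x‖) ^ 2 = (K * q ^ i * ‖x‖) ^ 2 / (4 * C) := by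
      rw [mul_pow, div_pow, mul_pow 2, hsq, mul_pow]; ring
    rw [e, div_le_iff₀ (by positivity)]
    have hwn : 0 ≤ w n := sq_nonneg _
    rcases lt_or_ge i n with hin | hin
    · have h1 := le_of_sum_Ico_le hC (fun i => sq_nonneg _) hseg hin
      have h2 := hlow i
      have h0 : w 0 = ‖x‖ ^ 2 := by simp [hw]
      change w i ≤ C * (1 - 1 / C) ^ i * w 0 + 2 * C * w n at h1
      rw [h0] at h1
      have hθ0 : 0 ≤ 1 - 1 / C := by
        rw [sub_nonneg, div_le_one (by linarith)]; exact hC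
      have h3 : (1 - 1 / C) ^ i ≤ (q ^ 2) ^ i * (q ^ 2) ^ i := by
        rw [← mul_pow]
        exact pow_le_pow_left₀ hθ0 (hqC.trans_eq (by ring)) i
      have h4 : C * (1 - 1 / C) ^ i * ‖x‖ ^ 2 ≤ (K * q ^ i * ‖x‖) ^ 2 / 2 := by
        calc C * (1 - 1 / C) ^ i * ‖x‖ ^ 2
            ≤ C * ((q ^ 2) ^ i * (q ^ 2) ^ i) * ‖x‖ ^ 2 := by gcongr
          _ = ((q ^ 2) ^ i * (2 * C)) * ((q ^ 2) ^ i * ‖x‖ ^ 2) / 2 := by ring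
          _ ≤ K ^ 2 * ((q ^ 2) ^ i * ‖x‖ ^ 2) / 2 := by gcongr
          _ = _ := by rw [mul_pow, mul_pow, ← pow_mul, ← pow_mul, mul_comm i]; ring
      linarith
    · have h1 : (K * q ^ i * ‖x‖) ^ 2 ≤ (K * q ^ n * ‖x‖) ^ 2 := by
        have := pow_le_pow_of_le_one hq0.le hq1.le hin
        gcongr
      have h2 := hlow n
      nlinarith
  have h1 := abs_le_of_sq_le_sq' hfin (by positivity)
  have h2 := (le_div_iff₀ (by positivity)).1 h1.2
  calc _ = K * q ^ i / (2 * Real.sqrt C) * ‖x‖ * t ^ n := by ring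
    _ ≤ _ := h2

/-- Boundedness below of `z - T` on the closed disc of radius `r`, together with some geometric
growth of orbits, gives growth of order `r`. -/
theorem HasOrbitGrowth.of_boundedBelow {T : H →L[ℂ] H} {c r s : ℝ} (hc : 0 < c) (hr : 0 < r)
    (h : ∀ z : ℂ, ‖z‖ ≤ r → ∀ x, c * ‖x‖ ≤ ‖(z • (1 : H →L[ℂ] H) - T) x‖)
    (hs : 0 < s) (hg : HasOrbitGrowth T s) : HasOrbitGrowth T r := by
  set C : ℝ := 1 + r ^ 2 / c ^ 2 with hCdef
  have hC : 1 ≤ C := by have : 0 ≤ r ^ 2 / c ^ 2 := by positivity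
                        linarith
  have hrC : r ^ 2 ≤ C * c ^ 2 := by
    rw [hCdef, add_mul, div_mul_cancel₀ _ (by positivity)]; nlinarith [sq_nonneg c]
  have hC1 : 1 / C ≤ 1 := by rw [div_le_one (by linarith)]; exact hC
  have hC0 : 0 < 1 / C := by positivity
  -- Bernoulli's inequality gives `q ^ 4 ≥ 1 - 1 / C`.
  set q : ℝ := 1 - 1 / C / 4 with hq
  have hq0 : 0 < q := by linarith
  have hq1 : q < 1 := by linarith
  have hqC : 1 - 1 / C ≤ q ^ 4 := by
    have := one_add_mul_le_pow (a := -(1 / C / 4)) (by linarith) 4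
    rw [hq, sub_eq_add_neg 1 (1 / C / 4)]
    refine le_trans (le_of_eq ?_) this
    push_cast; ring
  obtain ⟨m, hm⟩ := exists_pow_lt_of_lt_one (div_pos hs hr) hq1
  rw [lt_div_iff₀ hr] at hm
  have key : ∀ k, HasOrbitGrowth T (q ^ k * r) → HasOrbitGrowth T r := by
    intro k
    induction k with
    | zero => intro hk; simpa using hk
    | succ k ih =>
      intro hk
      refine ih (HasOrbitGrowth.of_mul hc (by positivity) ?_ h hC hrC hq0 hq1 hqC ?_)
      · exact mul_le_of_le_one_left hr.le (pow_le_one₀ hq0.le hq1.le)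
      · rwa [pow_succ', mul_assoc] at hk
  exact key m (hg.mono (by positivity) hm.le)

theorem HasOrbitGrowth.of_mul_eq_one {S T : H →L[ℂ] H} (h : S * T = 1) :
    ∃ s, 0 < s ∧ HasOrbitGrowth T s := by
  refine ⟨(‖S‖ + 1)⁻¹, by positivity, 1, one_pos, fun n x => ?_⟩
  have hST : ∀ y, S (T y) = y := fun y => congrArg (fun A : H →L[ℂ] H => A y) h
  induction n with
  | zero => simp
  | succ n ih =>
    have h1 := S.le_opNorm (T ((T ^ n) x))
    rw [hST] at h1
    rw [pow_succ' T]
    change _ ≤ ‖T ((T ^ n) x)‖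
    have h2 : (‖S‖ + 1)⁻¹ * ‖(T ^ n) x‖ ≤ ‖T ((T ^ n) x)‖ := by
      rw [inv_mul_le_iff₀ (by positivity)]
      nlinarith [norm_nonneg (T ((T ^ n) x))]
    refine le_trans ?_ h2
    rw [pow_succ']
    calc _ = (‖S‖ + 1)⁻¹ * (1 * (‖S‖ + 1)⁻¹ ^ n * ‖x‖) := by ring
      _ ≤ _ := by gcongr

end Growth

/-! ### Left inverses and the left spectrum. -/

section LeftInverse

variable {H : Type*} [NormedAddCommGroup H] [InnerProductSpace ℂ H]

/-- On a compact set of the left resolvent set, `z - T` is uniformly bounded below. -/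
theorem exists_boundedBelow_of_isCompact {T : H →L[ℂ] H} {s : Set ℂ} (hs : IsCompact s)
    (hsub : s ⊆ leftResolventSet T) :
    ∃ c : ℝ, 0 < c ∧ ∀ z ∈ s, ∀ x, c * ‖x‖ ≤ ‖(z • (1 : H →L[ℂ] H) - T) x‖ := by
  refine hs.induction_on (p := fun s => ∃ c : ℝ, 0 < c ∧
    ∀ z ∈ s, ∀ x, c * ‖x‖ ≤ ‖(z • (1 : H →L[ℂ] H) - T) x‖) ⟨1, one_pos, by simp⟩ ?_ ?_ ?_
  · rintro s t hst ⟨c, hc, h⟩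
    exact ⟨c, hc, fun z hz => h z (hst hz)⟩
  · rintro s t ⟨c, hc, h⟩ ⟨c', hc', h'⟩
    refine ⟨min c c', lt_min hc hc', ?_⟩
    rintro z (hz | hz) x
    · exact le_trans (by gcongr; exact min_le_left _ _) (h z hz x)
    · exact le_trans (by gcongr; exact min_le_right _ _) (h' z hz x)
  · intro z hz
    obtain ⟨L, hL⟩ := hsub hz
    have hc : 0 < 1 / (2 * (‖L‖ + 1)) := by positivity
    refine ⟨Metric.ball z (1 / (2 * (‖L‖ + 1))),
      mem_nhdsWithin_of_mem_nhds (Metric.ball_mem_nhds _ hc), _, hc, fun w hw x => ?_⟩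
    set c := 1 / (2 * (‖L‖ + 1)) with hcdef
    have h1 : ‖x‖ ≤ ‖L‖ * ‖(z • (1 : H →L[ℂ] H) - T) x‖ := by
      have := L.le_opNorm ((z • (1 : H →L[ℂ] H) - T) x)
      rwa [show L ((z • (1 : H →L[ℂ] H) - T) x) = x from
        congrArg (fun A : H →L[ℂ] H => A x) hL] at this
    have h2 : 2 * c * ‖x‖ ≤ ‖(z • (1 : H →L[ℂ] H) - T) x‖ := by
      have e : 2 * c * ‖x‖ = ‖x‖ / (‖L‖ + 1) := by rw [hcdef]; field_simp
      rw [e, div_le_iff₀ (by positivity)]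
      nlinarith [norm_nonneg ((z • (1 : H →L[ℂ] H) - T) x)]
    have h3 : (z • (1 : H →L[ℂ] H) - T) x = (w • (1 : H →L[ℂ] H) - T) x + (z - w) • x := by
      simp [sub_smul]
    have h4 : ‖(z - w) • x‖ ≤ c * ‖x‖ := by
      rw [norm_smul, ← dist_eq_norm, dist_comm]
      exact mul_le_mul_of_nonneg_right (Metric.mem_ball.1 hw).le (norm_nonneg x)
    have h5 := norm_add_le ((w • (1 : H →L[ℂ] H) - T) x) ((z - w) • x)
    rw [← h3] at h5
    linarith

open Finset ContinuousLinearMap in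
/-- If `‖T ^ n x‖ ≥ ρ ^ n ‖x‖` for one `n ≥ 1`, then `T` has a left inverse of spectral radius at
most `1 / ρ`: the Moore-Penrose inverse for an equivalent inner product. -/
theorem exists_leftInverse_spectrum_le [CompleteSpace H] {T : H →L[ℂ] H} {ρ : ℝ} (hρ : 0 < ρ)
    {n : ℕ} (hn : n ≠ 0) (h : ∀ x, ρ ^ n * ‖x‖ ≤ ‖(T ^ n) x‖) :
    ∃ S : H →L[ℂ] H, S * T = 1 ∧ ∀ z ∈ spectrum ℂ S, ‖z‖ ≤ 1 / ρ := by
  set a : ℝ := 1 / ρ ^ 2 with ha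
  have ha0 : 0 < a := by positivity
  -- `B` is the Gram operator of the new inner product, `Q` its squared norm.
  set B : H →L[ℂ] H := ∑ k ∈ range n, ((a : ℂ) ^ k) • (adjoint (T ^ k) * T ^ k) with hBdef
  set Q : H → ℝ := fun x => ∑ k ∈ range n, a ^ k * ‖(T ^ k) x‖ ^ 2 with hQdef
  have hB : ∀ x y, inner ℂ (B x) y =
      ∑ k ∈ range n, (a : ℂ) ^ k * inner ℂ ((T ^ k) x) ((T ^ k) y) := by
    intro x y
    rw [hBdef, _root_.sum_apply, sum_inner]
    refine sum_congr rfl fun k _ => ?_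
    simp [inner_smul_left, adjoint_inner_left]
  have hBQ : ∀ x, inner ℂ (B x) x = (Q x : ℂ) := by
    intro x
    rw [hB]; simp only [hQdef]; push_cast
    refine sum_congr rfl fun k _ => ?_
    rw [inner_self_eq_norm_sq_to_K]; rfl
  have hsymm : ∀ x y, inner ℂ (B x) y = (starRingEnd ℂ) (inner ℂ (B y) x) := by
    intro x y
    rw [hB, hB, map_sum]
    refine sum_congr rfl fun k _ => ?_
    rw [map_mul, inner_conj_symm]; simp
  have hQ0 : ∀ x, 0 ≤ Q x := fun x => sum_nonneg fun k _ => by positivity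
  have hQge : ∀ x, ‖x‖ ^ 2 ≤ Q x := fun x => by
    have := single_le_sum (f := fun k => a ^ k * ‖(T ^ k) x‖ ^ 2) (s := range n)
      (fun k _ => by positivity) (mem_range.2 (Nat.pos_of_ne_zero hn))
    rw [pow_zero, pow_zero, one_mul] at this
    exact this
  have hQle : ∀ x, Q x ≤ ‖B‖ * ‖x‖ ^ 2 := fun x => by
    have h1 : ‖inner ℂ (B x) x‖ = Q x := by rw [hBQ]; simp [abs_of_nonneg (hQ0 x)]
    rw [← h1]
    refine (norm_inner_le_norm _ _).trans ?_
    have := B.le_opNorm x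
    nlinarith [norm_nonneg x]
  -- The two sums differ only in their end terms, which `h` compares.
  have hQT : ∀ x, Q x ≤ a * Q (T x) := fun x => by
    have e1 : a * Q (T x) = ∑ k ∈ range n, a ^ (k + 1) * ‖(T ^ (k + 1)) x‖ ^ 2 := by
      simp only [hQdef]
      rw [mul_sum]
      refine sum_congr rfl fun k _ => ?_
      rw [pow_succ T]
      change _ = a ^ (k + 1) * ‖(T ^ k) (T x)‖ ^ 2
      ring
    have e2 := sum_range_succ (fun k => a ^ k * ‖(T ^ k) x‖ ^ 2) n
    rw [sum_range_succ'] at e2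
    have e3 : ‖x‖ ^ 2 ≤ a ^ n * ‖(T ^ n) x‖ ^ 2 := by
      have := pow_le_pow_left₀ (by positivity) (h x) 2
      rw [ha, div_pow, one_pow, one_div, ← div_eq_inv_mul, le_div_iff₀ (by positivity)]
      refine le_trans (le_of_eq ?_) this
      rw [mul_pow, ← pow_mul, ← pow_mul, mul_comm 2 n]; ring
    rw [e1]
    simp only [pow_zero, one_mul, one_apply_eq_self] at e2
    simp only [hQdef]
    linarith
  set G : H →L[ℂ] H := adjoint T * B * T with hG
  have hGinner : ∀ x, inner ℂ (G x) x = (Q (T x) : ℂ) := fun x => by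
    rw [← hBQ]; exact adjoint_inner_left T x (B (T x))
  have hGu : IsUnit G := by
    refine isUnit_of_forall_le_norm_inner_map G (c := ⟨ρ ^ 2, by positivity⟩)
      (show (0 : ℝ) < ρ ^ 2 by positivity) fun x => ?_
    rw [hGinner]
    have h1 := (hQge x).trans (hQT x)
    rw [ha, one_div, ← div_eq_inv_mul, le_div_iff₀ (by positivity)] at h1
    rw [Complex.norm_real, Real.norm_of_nonneg (hQ0 _)]
    exact h1
  obtain ⟨g, hg⟩ := hGu
  have hg1 : (↑g⁻¹ : H →L[ℂ] H) * G = 1 := by rw [← hg]; exact g.inv_mul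
  have hg2 : G * (↑g⁻¹ : H →L[ℂ] H) = 1 := by rw [← hg]; exact g.mul_inv
  -- With this `S`, `T * S` is the `Q`-orthogonal projection onto the range of `T`; Pythagoras then
  -- bounds `Q (T (S x))` by `Q x`.
  set S : H →L[ℂ] H := ↑g⁻¹ * (adjoint T * B) with hS
  have hQS : ∀ x, Q (S x) ≤ a * Q x := by
    intro x
    have h0 : adjoint T (B (x - T (S x))) = 0 := by
      have h1 : adjoint T * B * T * S = adjoint T * B := by
        rw [hS, ← mul_assoc, ← hG, hg2, one_mul]
      have h2 : adjoint T (B (T (S x))) = adjoint T (B x) :=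
        congrArg (fun A : H →L[ℂ] H => A x) h1
      rw [map_sub, map_sub, h2, sub_self]
    have h1 : inner ℂ (B (x - T (S x))) (T (S x)) = 0 := by
      rw [← adjoint_inner_left, h0, inner_zero_left]
    have h2 : inner ℂ (B (T (S x))) (x - T (S x)) = 0 := by rw [hsymm, h1, map_zero]
    have h3 : (Q x : ℂ) = Q (x - T (S x)) + Q (T (S x)) := by
      rw [← hBQ, ← hBQ, ← hBQ]
      conv_lhs => rw [← sub_add_cancel x (T (S x))]
      rw [map_add, inner_add_left, inner_add_right, inner_add_right, h1, h2]
      ring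
    have h4 : Q x = Q (x - T (S x)) + Q (T (S x)) := by exact_mod_cast h3
    refine (hQT (S x)).trans (mul_le_mul_of_nonneg_left ?_ ha0.le)
    linarith [hQ0 (x - T (S x))]
  refine ⟨S, by rw [hS, mul_assoc, ← hG, hg1], fun z hz => ?_⟩
  have hQpow : ∀ j x, Q ((S ^ j) x) ≤ a ^ j * Q x := by
    intro j x
    induction j with
    | zero => simp
    | succ j ih =>
      rw [pow_succ' S]
      refine (hQS ((S ^ j) x)).trans ?_
      rw [pow_succ', mul_assoc]
      exact mul_le_mul_of_nonneg_left ih ha0.le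
  have hSn : ∀ j, ‖S ^ j‖ ≤ Real.sqrt (a ^ j * ‖B‖) := by
    intro j
    refine opNorm_le_bound _ (Real.sqrt_nonneg _) fun x => ?_
    refine le_of_sq_le_sq ?_ (by positivity)
    rw [mul_pow, Real.sq_sqrt (by positivity), mul_assoc]
    exact (hQge _).trans ((hQpow j x).trans (mul_le_mul_of_nonneg_left (hQle x) (by positivity)))
  have hz2 : ∀ j : ℕ, ((‖z‖ * ρ) ^ 2) ^ j ≤ ‖B‖ := by
    intro j
    have h1 := spectrum.norm_le_norm_mul_of_mem (spectrum.pow_mem_pow S j hz)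
    have h2 : ‖z‖ ^ j ≤ Real.sqrt (a ^ j * ‖B‖) := by
      rw [← norm_pow]
      refine (h1.trans ?_).trans (hSn j)
      exact mul_le_of_le_one_right (norm_nonneg _) norm_id_le
    have h3 := pow_le_pow_left₀ (by positivity) h2 2
    rw [Real.sq_sqrt (by positivity), ha, div_pow, one_pow, div_mul_eq_mul_div, one_mul,
      le_div_iff₀ (by positivity)] at h3
    refine le_trans (le_of_eq ?_) h3
    rw [mul_pow, mul_pow, pow_right_comm]
  rw [le_div_iff₀ hρ]
  by_contra! hlt
  obtain ⟨j, hj⟩ := pow_unbounded_of_one_lt ‖B‖ (show 1 < (‖z‖ * ρ) ^ 2 by nlinarith)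
  exact absurd (hz2 j) (not_le.2 hj)

/-- Were every `z - T` left invertible, the resolvent set would be closed: a left inverse `L` at a
limit point `z` has `L (w - T)` invertible for nearby `w`, so `L`, hence `z - T`, is invertible. By
connectedness of `ℂ` the spectrum would be empty or all of `ℂ`. -/
theorem leftSpectrum_nonempty [CompleteSpace H] [Nontrivial H] (T : H →L[ℂ] H) :
    (leftSpectrum T).Nonempty := by
  by_contra hne
  have hall : ∀ z, z ∈ leftResolventSet T := fun z => by
    by_contra hz; exact hne ⟨z, hz⟩
  have hcl : IsClosed (resolventSet ℂ T) := by
    rw [← closure_subset_iff_isClosed]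
    intro z hz
    obtain ⟨L, hL⟩ := hall z
    have hcont : Continuous fun w : ℂ => L * (w • (1 : H →L[ℂ] H) - T) := by fun_prop
    have hnhds : {w : ℂ | IsUnit (L * (w • (1 : H →L[ℂ] H) - T))} ∈ nhds z :=
      (Units.isOpen.preimage hcont).mem_nhds (by simp [hL])
    obtain ⟨w, hw1, hw2⟩ := mem_closure_iff_nhds.1 hz _ hnhds
    have hw2' : IsUnit (w • (1 : H →L[ℂ] H) - T) := by
      simpa [Algebra.algebraMap_eq_smul_one] using spectrum.mem_resolventSet_iff.1 hw2
    obtain ⟨u, hu⟩ := hw2'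
    have hLu : IsUnit L := by
      rw [Set.mem_ofPred_eq, ← hu] at hw1
      simpa using hw1
    rw [spectrum.mem_resolventSet_iff, Algebra.algebraMap_eq_smul_one]
    obtain ⟨v, rfl⟩ := hLu
    rw [Units.eq_inv_of_mul_eq_one_left hL]
    exact v⁻¹.isUnit
  rcases isClopen_iff.1 ⟨hcl, spectrum.isOpen_resolventSet (𝕜 := ℂ) T⟩ with he | he
  · have hb := (spectrum.isBounded (𝕜 := ℂ) T)
    rw [spectrum, he, Set.compl_empty] at hb
    exact NormedSpace.unbounded_univ ℂ ℂ hb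
  · have := spectrum.nonempty T
    rw [spectrum, he, Set.compl_univ] at this
    exact Set.not_nonempty_empty this

theorem mem_leftResolventSet_of_isUnit {S T : H →L[ℂ] H} (hST : S * T = 1) {z : ℂ}
    (hz : IsUnit (1 - z • S)) : z ∈ leftResolventSet T := by
  obtain ⟨u, hu⟩ := hz
  refine ⟨-(↑u⁻¹ * S), ?_⟩
  have h1 : S * (z • (1 : H →L[ℂ] H) - T) = -(1 - z • S) := by
    rw [mul_sub, hST, mul_smul_comm, mul_one]; abel
  rw [neg_mul, mul_assoc, h1, ← hu, mul_neg, neg_neg, u.inv_mul]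

end LeftInverse

/-! ### The distance formula. -/

theorem corollary2p5 {H : Type*} [NormedAddCommGroup H] [InnerProductSpace ℂ H]
    [CompleteSpace H] [TopologicalSpace.SeparableSpace H] (hH : ¬ FiniteDimensional ℂ H)
    (T : H →L[ℂ] H) (hT : (0 : ℂ) ∈ leftResolventSet T) :
    (leftSpectrum T).Nonempty ∧
    (∀ S : H →L[ℂ] H, S * T = 1 → 0 < (spectralRadius ℂ S).toReal) ∧
    IsLUB {x : ℝ | ∃ S : H →L[ℂ] H, S * T = 1 ∧ x = 1 / (spectralRadius ℂ S).toReal}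
      (Metric.infDist (0 : ℂ) (leftSpectrum T)) := by
  have hnt : Nontrivial H := by
    by_contra hn
    rw [not_nontrivial_iff_subsingleton] at hn
    exact hH inferInstance
  have hne := leftSpectrum_nonempty T
  have hfin : ∀ S : H →L[ℂ] H, spectralRadius ℂ S ≠ ⊤ := fun S =>
    ((spectrum.spectralRadius_le_nnnorm S).trans_lt ENNReal.coe_lt_top).ne
  have hdisc : ∀ S : H →L[ℂ] H, S * T = 1 → ∀ z ∈ leftSpectrum T,
      (spectralRadius ℂ S)⁻¹ ≤ (‖z‖₊ : ENNReal) := fun S hS z hz => by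
    by_contra! hlt
    exact hz (mem_leftResolventSet_of_isUnit hS
      (spectrum.isUnit_one_sub_smul_of_lt_inv_radius hlt))
  have hpos : ∀ S : H →L[ℂ] H, S * T = 1 → 0 < (spectralRadius ℂ S).toReal := fun S hS => by
    -- At radius `0` the inverse is `⊤`, which no point of the left spectrum can dominate.
    refine ENNReal.toReal_pos (fun h0 => ?_) (hfin S)
    obtain ⟨z, hz⟩ := hne
    have := hdisc S hS z hz
    simp [h0] at this
  refine ⟨hne, hpos, ?_, ?_⟩
  · rintro _ ⟨S, hS, rfl⟩
    refine (Metric.le_infDist hne).2 fun z hz => ?_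
    have h1 := ENNReal.toReal_mono ENNReal.coe_ne_top (hdisc S hS z hz)
    rw [dist_zero_left, one_div, ← ENNReal.toReal_inv]
    simpa using h1
  · intro b hb
    obtain ⟨L, hL⟩ := hT
    have hS₀ : -L * T = 1 := by simpa using hL
    have hb0 : 0 < b :=
      (one_div_pos.2 (hpos _ hS₀)).trans_le (hb ⟨-L, hS₀, rfl⟩)
    refine le_of_forall_lt fun ρ hρ => ?_
    rcases le_or_gt ρ 0 with hρ0 | hρ0
    · exact hρ0.trans_lt hb0
    -- The gap from `ρ'` to `r` absorbs `K`; the gap from `ρ` to `ρ'` keeps the final inequality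
    -- strict.
    obtain ⟨ρ', hρρ', hρ'⟩ := exists_between hρ
    obtain ⟨r, hρ'r, hr⟩ := exists_between hρ'
    have hρ'0 : 0 < ρ' := hρ0.trans hρρ'
    have hr0 : 0 < r := hρ'0.trans hρ'r
    have hsub : Metric.closedBall (0 : ℂ) r ⊆ leftResolventSet T := fun z hz => by
      by_contra hz'
      have := Metric.infDist_le_dist_of_mem (x := (0 : ℂ)) (show z ∈ leftSpectrum T from hz')
      rw [dist_comm] at this
      exact absurd (this.trans (Metric.mem_closedBall.1 hz)) (not_le.2 hr)
    obtain ⟨c, hc, hcb⟩ :=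
      exists_boundedBelow_of_isCompact (isCompact_closedBall (0 : ℂ) r) hsub
    obtain ⟨s, hs, hgs⟩ := HasOrbitGrowth.of_mul_eq_one hS₀
    obtain ⟨K, hK, hg⟩ := HasOrbitGrowth.of_boundedBelow hc hr0
      (fun z hz => hcb z (by simpa using hz)) hs hgs
    obtain ⟨n, hn⟩ := exists_pow_lt_of_lt_one hK ((div_lt_one hr0).2 hρ'r)
    have hn' : (ρ' / r) ^ (n + 1) ≤ K := by
      refine le_trans ?_ hn.le
      exact pow_le_pow_of_le_one (by positivity) ((div_lt_one hr0).2 hρ'r).le n.le_succ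
    rw [div_pow, div_le_iff₀ (by positivity)] at hn'
    obtain ⟨S, hS, hspec⟩ := exists_leftInverse_spectrum_le hρ'0 n.succ_ne_zero
      (fun x => (mul_le_mul_of_nonneg_right hn' (norm_nonneg x)).trans (hg (n + 1) x))
    refine hρρ'.trans_le (le_trans ?_ (hb ⟨S, hS, rfl⟩))
    rw [le_div_iff₀ (hpos S hS), ← le_div_iff₀' hρ'0]
    refine ENNReal.toReal_le_of_le_ofReal (by positivity) (iSup₂_le fun z hz => ?_)
    change ‖z‖ₑ ≤ _
    rw [← ofReal_norm z]
    exact ENNReal.ofReal_le_ofReal (hspec z hz)
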